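/- A (finite simple) graph $G$ with $n$ vertices and $m$ edges is edge-magic if there are an integer $s$ and a bijection $l:V(G)\cup E(G)\to\{1,\dots,n+m\}$ (where $V(G)$ and $E(G)$ are regarded as disjoint) such that $l(a)+l(b)+l(ab)=s$ for every edge $ab$ of $G$. Let $\mathcal M(n)$ denote the maximum number of edges of an edge-magic graph on $n$ vertices. Then, as $n\to\infty$, $$\frac27\,n^2+O(n)\;\le\;\mathcal M(n)\;\le\;\left(c+o(1)\right)n^2,\qquad\text{where } c=\frac12-\frac{2}{\left(2+(1+2\sqrt2)\,\pi\right)^2}=0.489\ldots$$ -/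

import Mathlib

open Filter Topology Asymptotics

/-- `l` is an edge-magic labelling of the graph `G` with magic sum `s`: with `n` vertices and `m`
edges, `l` is a bijection from the disjoint union of the vertex set and the edge set onto
`{1, …, n + m}`, and `l a + l b + l ab = s` for every edge `ab`. -/
def IsEdgeMagicLabelling {V : Type*} (G : SimpleGraph V) (s : ℕ) (l : V ⊕ G.edgeSet → ℕ) : Prop :=
  Set.BijOn l Set.univ (Set.Icc 1 (Nat.card V + Nat.card G.edgeSet)) ∧
    ∀ (a b : V) (h : G.Adj a b),
      l (Sum.inl a) + l (Sum.inl b) + l (Sum.inr ⟨s(a, b), h⟩) = s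

/-- A graph is edge-magic if it has an edge-magic labelling for some magic sum. -/
def IsEdgeMagic {V : Type*} (G : SimpleGraph V) : Prop :=
  ∃ (s : ℕ) (l : V ⊕ G.edgeSet → ℕ), IsEdgeMagicLabelling G s l

/-- The numbers of edges of the edge-magic graphs of order `n`. -/
def edgeMagicSizes (n : ℕ) : Set ℕ :=
  {m | ∃ G : SimpleGraph (Fin n), IsEdgeMagic G ∧ Nat.card G.edgeSet = m}

/-- The maximum number of edges of an edge-magic graph of order `n`. -/
noncomputable def maxEdgeMagicSize (n : ℕ) : ℕ := sSup (edgeMagicSizes n)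

/-- The maximum is attained, for every `n`. -/
theorem maxEdgeMagicSize_isGreatest (n : ℕ) :
    IsGreatest (edgeMagicSizes n) (maxEdgeMagicSize n) := by
  have hfin : (edgeMagicSizes n).Finite := by
    refine (Set.finite_range fun G : SimpleGraph (Fin n) => Nat.card G.edgeSet).subset ?_
    rintro m ⟨G, -, rfl⟩
    exact ⟨G, rfl⟩
  have hne : (edgeMagicSizes n).Nonempty := by
    refine ⟨_, ⊥, ⟨0, Sum.elim (fun i => (i : ℕ) + 1) (fun _ => 0), ?_, ?_⟩, rfl⟩
    · have he : IsEmpty (⊥ : SimpleGraph (Fin n)).edgeSet := by simp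
      refine ⟨?_, ?_, ?_⟩
      · rintro (i | e) -
        · have := i.isLt
          simp only [Sum.elim_inl, Set.mem_Icc, Nat.card_eq_fintype_card, Fintype.card_fin]
          omega
        · exact he.elim e
      · rintro (i | e) - (j | f) - h
        · simp only [Sum.elim_inl] at h
          exact congrArg Sum.inl (Fin.ext (by omega))
        · exact he.elim f
        · exact he.elim e
        · exact he.elim e
      · intro k hk
        have h0 : Nat.card (⊥ : SimpleGraph (Fin n)).edgeSet = 0 := Nat.card_of_isEmpty
        rw [h0, Nat.card_eq_fintype_card, Fintype.card_fin, Set.mem_Icc] at hk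
        refine ⟨Sum.inl ⟨k - 1, by omega⟩, trivial, ?_⟩
        simp only [Sum.elim_inl]
        omega
    · intro a b h
      exact absurd h (by simp)
  exact ⟨Nat.sSup_mem hne hfin.bddAbove, fun m hm => le_csSup hfin.bddAbove hm⟩

/-- The constant `1/2 - 2 / (2 + (1 + 2√2) π)² = 0.489…`. -/
noncomputable def edgeMagicConst : ℝ :=
  1 / 2 - 2 / (2 + (1 + 2 * Real.sqrt 2) * Real.pi) ^ 2

/-!
An edge-magic labelling of a graph with `n` vertices and `m` edges amounts to a set `A` of `n`
vertex labels in `[1, N]`, `N = n + m`, together with distinct pairwise sums of elements of `A`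
that fill the `s`-reflection of `[1, N] \ A`.

*Lower bound.* If the sums of two distinct elements of `A` cover an interval of length `N`, each
label outside `A` can be given to an edge (`sub_mem_edgeMagicSizes`). Mrose's additive 2-basis has
`7t + 3` elements and covers `[1, 14t² + 10t - 1]` (`exists_add_eq_of_mroseBasis`); padding it to
`n` elements gives `(2/7) n² - O(n)` edges.

*Upper bound.* Put `X = n² - 2m`, the number of ordered nonadjacent pairs (the diagonal included).
The sums of adjacent labels occupy an interval of length `N` up to `n` gaps, so for every
nontrivial character modulo `N` the square of the exponential sum over `A` is at most `X + 2n` in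
absolute value (`norm_sum_pow_sq_le`): if `X` is small, then `A` is nearly equidistributed
modulo `N`.
On the other hand all sums of adjacent labels lie in an interval of length `N`, so the elements of
`A` whose double lies outside that interval are few: they are the disjoint union of two sets of
pairwise nonadjacent vertices, and there are at most `√(2X)` of them (`card_sq_add_card_sq_le`).
Modulo `N` they are exactly the points of `A` in a half-circle. Testing equidistribution against
the positive part of the sine that is supported on this half-circle, with the absolutely summable
Fourier series of `|sin|` (`div_sub_sum_cos_le_abs_sin`), gives
`2n - 4 ≤ (2 + (1 + 2√2) π) √(X + 2n)` (`IsEdgeMagicLabelling.two_mul_sub_four_le`), which is the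
claimed bound on `m` with an `O(n)` error.
-/

/-! ### The Fourier series of `|sin|` -/

/-- Up to the factor `1 / π`, the `n`-th Fourier coefficient of the `π`-periodic function `|sin|`. -/
theorem integral_exp_mul_sin_zero_pi (n : ℤ) :
    ∫ x in (0 : ℝ)..Real.pi, Complex.exp (-(2 * n * Complex.I) * x) * (Real.sin x : ℂ)
      = 2 / (1 - 4 * (n : ℂ) ^ 2) := by
  have hne : (1 - 4 * (n : ℂ) ^ 2) ≠ 0 := by
    have : (1 - 4 * n ^ 2 : ℤ) ≠ 0 := by omega
    exact_mod_cast this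
  set a : ℂ := -(2 * n * Complex.I) with ha
  have ha2 : a ^ 2 + 1 = 1 - 4 * (n : ℂ) ^ 2 := by
    rw [ha]; ring_nf; rw [Complex.I_sq]; ring
  have hderiv : ∀ x ∈ Set.uIcc (0 : ℝ) Real.pi,
      HasDerivAt (fun x : ℝ => Complex.exp (a * x) * (a * Complex.sin x - Complex.cos x)
        / (1 - 4 * (n : ℂ) ^ 2)) (Complex.exp (a * x) * (Real.sin x : ℂ)) x := by
    intro x _
    have h1 : HasDerivAt (fun z : ℂ => Complex.exp (a * z) * (a * Complex.sin z - Complex.cos z)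
        / (1 - 4 * (n : ℂ) ^ 2)) (Complex.exp (a * x) * (Real.sin x : ℂ)) (x : ℂ) := by
      have h2 := ((((hasDerivAt_id (x : ℂ)).const_mul a).cexp).mul
        (((Complex.hasDerivAt_sin (x : ℂ)).const_mul a).sub
          (Complex.hasDerivAt_cos (x : ℂ)))).div_const (1 - 4 * (n : ℂ) ^ 2)
      refine h2.congr_deriv ?_
      rw [div_eq_iff hne, ← ha2, Complex.ofReal_sin]
      simp only [id, mul_one, Pi.sub_apply]
      ring
    exact h1.comp_ofReal
  rw [intervalIntegral.integral_eq_sub_of_hasDerivAt hderiv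
    (Continuous.intervalIntegrable (by fun_prop) _ _)]
  have hexp : Complex.exp (a * Real.pi) = 1 := by
    rw [Complex.exp_eq_one_iff]
    exact ⟨-n, by rw [ha]; push_cast; ring⟩
  rw [hexp]
  simp
  ring

/-- The Fourier series `|sin x| = 2/π - (4/π) ∑ cos (2jx) / (4j² - 1)`, summed over `j ≥ 1`. -/
theorem hasSum_cos_div_four_mul_sq_sub_one (x : ℝ) :
    HasSum (fun j : ℕ => Real.cos (2 * (j + 1 : ℕ) * x) / (4 * ((j + 1 : ℕ) : ℝ) ^ 2 - 1))
      (1 / 2 - Real.pi / 4 * |Real.sin x|) := by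
  have : Fact (0 < Real.pi) := ⟨Real.pi_pos⟩
  have hper : Function.Periodic (fun x : ℝ => ((|Real.sin x| : ℝ) : ℂ)) Real.pi := by
    intro x
    simp [Real.sin_add_pi]
  let f : C(AddCircle Real.pi, ℂ) :=
    ⟨hper.lift, continuous_coinduced_dom.mpr (by
      change Continuous (fun x : ℝ => ((|Real.sin x| : ℝ) : ℂ))
      fun_prop)⟩
  have hf : ∀ x : ℝ, f (x : AddCircle Real.pi) = ((|Real.sin x| : ℝ) : ℂ) := fun x => rfl
  have hcoeff : ∀ n : ℤ, fourierCoeff f n = 2 / (Real.pi * (1 - 4 * (n : ℂ) ^ 2)) := by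
    intro n
    rw [fourierCoeff_eq_intervalIntegral f n 0, zero_add]
    have : ∫ x in (0 : ℝ)..Real.pi, fourier (-n) (x : AddCircle Real.pi) • f x
        = 2 / (1 - 4 * (n : ℂ) ^ 2) := by
      rw [← integral_exp_mul_sin_zero_pi]
      refine intervalIntegral.integral_congr fun x hx => ?_
      rw [Set.uIcc_of_le Real.pi_pos.le] at hx
      simp only [smul_eq_mul]
      rw [hf, abs_of_nonneg (Real.sin_nonneg_of_nonneg_of_le_pi hx.1 hx.2), fourier_coe_apply]
      congr 2
      have : (Real.pi : ℂ) ≠ 0 := by exact_mod_cast Real.pi_ne_zero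
      field_simp
      push_cast
      ring
    rw [this, Complex.real_smul]
    push_cast
    rw [div_mul_div_comm, one_mul]
  have hsum : Summable (fourierCoeff f) := by
    have h1 : Summable (fun n : ℤ => 1 / (n : ℝ) ^ 2) := by
      exact Real.summable_one_div_int_pow.mpr (by norm_num)
    refine Summable.of_norm_bounded_eventually (h1) ?_
    have h0 : {(0 : ℤ)}ᶜ ∈ (cofinite : Filter ℤ) := (Set.finite_singleton 0).compl_mem_cofinite
    filter_upwards [h0] with n hn
    have hn : n ≠ 0 := by simpa using hn
    rw [hcoeff]
    have h2 : (2 / (Real.pi * (1 - 4 * (n : ℂ) ^ 2)))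
        = ((2 / (Real.pi * (1 - 4 * (n : ℝ) ^ 2)) : ℝ) : ℂ) := by push_cast; rfl
    rw [h2, Complex.norm_real, Real.norm_eq_abs, abs_div, abs_mul, abs_of_pos Real.pi_pos,
      abs_of_pos (two_pos), abs_of_neg]
    · have h3 : (1 : ℝ) ≤ (n : ℝ) ^ 2 := by
        have : (1 : ℤ) ≤ n ^ 2 := by have := Int.one_le_abs hn; nlinarith [sq_abs n]
        exact_mod_cast this
      rw [div_le_div_iff₀ (mul_pos Real.pi_pos (by linarith)) (by linarith)]
      nlinarith [Real.pi_gt_three]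
    · have : (1 : ℝ) ≤ (n : ℝ) ^ 2 := by
        have : (1 : ℤ) ≤ n ^ 2 := by have := Int.one_le_abs hn; nlinarith [sq_abs n]
        exact_mod_cast this
      linarith
  have key := (has_pointwise_sum_fourier_series_of_summable hsum (x : AddCircle Real.pi)).nat_add_neg
  rw [hf] at key
  have hpi : (Real.pi : ℂ) ≠ 0 := by exact_mod_cast Real.pi_ne_zero
  have hterm : ∀ n : ℕ, fourierCoeff f n • fourier (n : ℤ) (x : AddCircle Real.pi)
        + fourierCoeff f (-n : ℤ) • fourier (-n : ℤ) (x : AddCircle Real.pi)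
      = ((4 / (Real.pi * (1 - 4 * (n : ℝ) ^ 2)) * Real.cos (2 * n * x) : ℝ) : ℂ) := by
    intro n
    rw [hcoeff, hcoeff, fourier_coe_apply, fourier_coe_apply]
    push_cast
    rw [Complex.cos, neg_sq]
    have e1 : 2 * (Real.pi : ℂ) * Complex.I * n * x / Real.pi = 2 * n * x * Complex.I := by
      field_simp
    have e2 : 2 * (Real.pi : ℂ) * Complex.I * (-n) * x / Real.pi = -(2 * n * x) * Complex.I := by
      field_simp
    rw [e1, e2]
    simp only [smul_eq_mul]
    ring
  simp only [hterm] at key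
  have h0 : fourierCoeff f 0 • fourier 0 (x : AddCircle Real.pi) = ((2 / Real.pi : ℝ) : ℂ) := by
    rw [hcoeff]; simp
  rw [h0, ← Complex.ofReal_add, Complex.hasSum_ofReal] at key
  rw [← hasSum_nat_add_iff' 1] at key
  have key2 := key.mul_left (-(Real.pi / 4))
  have hval : 1 / 2 - Real.pi / 4 * |Real.sin x| = -(Real.pi / 4) * (|Real.sin x| + 2 / Real.pi
      - ∑ i ∈ Finset.range 1,
        4 / (Real.pi * (1 - 4 * (i : ℝ) ^ 2)) * Real.cos (2 * i * x)) := by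
    have := Real.pi_ne_zero
    simp only [Finset.sum_range_one, Nat.cast_zero, mul_zero, zero_mul, Real.cos_zero]
    field_simp
    ring
  rw [hval]
  refine (congrArg (fun F : ℕ → ℝ => HasSum F _) (funext fun j => ?_)).mpr key2
  have h' : (1 - 4 * ((j + 1 : ℕ) : ℝ) ^ 2) ≠ 0 := by
    push_cast
    nlinarith [(Nat.cast_nonneg j : (0 : ℝ) ≤ j)]
  rw [show 4 * ((j + 1 : ℕ) : ℝ) ^ 2 - 1 = -(1 - 4 * ((j + 1 : ℕ) : ℝ) ^ 2) by ring]
  have := Real.pi_ne_zero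
  field_simp

theorem sum_one_div_four_mul_sq_sub_one (J : ℕ) :
    ∑ j ∈ Finset.range J, 1 / (4 * ((j + 1 : ℕ) : ℝ) ^ 2 - 1) = (J : ℝ) / (2 * J + 1) := by
  induction J with
  | zero => simp
  | succ J ih =>
    rw [Finset.sum_range_succ, ih]
    have h1 : (4 * ((J + 1 : ℕ) : ℝ) ^ 2 - 1) = (2 * J + 1) * (2 * J + 3) := by push_cast; ring
    rw [h1]
    push_cast
    have h2 : (2 * (J : ℝ) + 1) ≠ 0 := by positivity
    have h3 : (2 * (J : ℝ) + 3) ≠ 0 := by positivity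
    have h4 : (2 * ((J : ℝ) + 1) + 1) ≠ 0 := by positivity
    field_simp
    ring

/-- A truncated form of the Fourier series of `|sin|`. Subtracting the series at `x` from the one
at `0` makes all terms nonnegative, so that every partial sum is a lower bound. -/
theorem div_sub_sum_cos_le_abs_sin (J : ℕ) (x : ℝ) :
    (J : ℝ) / (2 * J + 1)
      - ∑ j ∈ Finset.range J, Real.cos (2 * (j + 1 : ℕ) * x) / (4 * ((j + 1 : ℕ) : ℝ) ^ 2 - 1)
      ≤ Real.pi / 4 * |Real.sin x| := by
  have h := (hasSum_cos_div_four_mul_sq_sub_one 0).sub (hasSum_cos_div_four_mul_sq_sub_one x)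
  have hle := sum_le_hasSum (Finset.range J) (fun j _ => ?_) h
  · rw [Finset.sum_sub_distrib] at hle
    simp only [mul_zero, Real.cos_zero, Real.sin_zero, abs_zero,
      sum_one_div_four_mul_sq_sub_one] at hle
    linarith
  · rw [← sub_div]
    refine div_nonneg ?_ ?_
    · have := Real.cos_le_one (2 * (j + 1 : ℕ) * x)
      simp only [mul_zero, Real.cos_zero]
      linarith
    · push_cast; nlinarith [(Nat.cast_nonneg j : (0:ℝ) ≤ j)]

/-! ### Exponential sums over the vertex labels -/

theorem sum_Icc_pow_eq_zero {z : ℂ} {N : ℕ} (hzN : z ^ N = 1) (hz : z ≠ 1) :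
    ∑ x ∈ Finset.Icc 1 N, z ^ x = 0 := by
  have h1 : ∑ x ∈ Finset.Icc 1 N, z ^ x = ∑ x ∈ Finset.range N, z ^ (x + 1) := by
    rw [← Finset.Ico_add_one_right_eq_Icc, Finset.sum_Ico_eq_sum_range]
    simp [add_comm]
  simp_rw [h1, pow_succ, ← Finset.sum_mul]
  have h2 := geom_sum_mul z N
  rw [hzN, sub_self, mul_eq_zero] at h2
  rw [h2.resolve_right (sub_ne_zero.mpr hz), zero_mul]

theorem SimpleGraph.sum_dart_edge {V M : Type*} [Fintype V] [DecidableEq V] [AddCommMonoid M]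
    (G : SimpleGraph V) [DecidableRel G.Adj] (g : G.edgeSet → M) :
    ∑ d : G.Dart, g ⟨d.edge, d.edge_mem⟩ = 2 • ∑ e, g e := by
  rw [← Finset.sum_fiberwise' Finset.univ (fun d : G.Dart => (⟨d.edge, d.edge_mem⟩ : G.edgeSet)) g,
    Finset.smul_sum]
  refine Finset.sum_congr rfl fun e _ => ?_
  rw [Finset.sum_const]
  congr 1
  rw [← G.dart_edge_fiber_card e.1 e.2]
  congr 1
  ext d
  simp [Subtype.ext_iff]

namespace IsEdgeMagicLabelling

variable {V : Type*} {G : SimpleGraph V} {s : ℕ} {l : V ⊕ G.edgeSet → ℕ}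

theorem one_le (h : IsEdgeMagicLabelling G s l) (x : V ⊕ G.edgeSet) : 1 ≤ l x :=
  (h.1.mapsTo (Set.mem_univ x)).1

theorem le_card (h : IsEdgeMagicLabelling G s l) (x : V ⊕ G.edgeSet) :
    l x ≤ Nat.card V + Nat.card G.edgeSet :=
  (h.1.mapsTo (Set.mem_univ x)).2

variable [Fintype V]

/-- The labels form a complete residue system modulo `n + m`, so a nontrivial character sums to
zero over them. -/
theorem sum_pow_add_sum_pow_eq_zero [Fintype G.edgeSet] (h : IsEdgeMagicLabelling G s l) {z : ℂ}
    (hzN : z ^ (Nat.card V + Nat.card G.edgeSet) = 1) (hz : z ≠ 1) :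
    ∑ v, z ^ l (Sum.inl v) + ∑ e, z ^ l (Sum.inr e) = 0 := by
  rw [← Fintype.sum_sum_type (fun x => z ^ l x), ← sum_Icc_pow_eq_zero hzN hz]
  refine Finset.sum_nbij l (fun x _ => ?_) (fun x _ y _ hxy => ?_) (fun x hx => ?_) (fun _ _ => rfl)
  · exact Finset.mem_Icc.mpr ⟨h.one_le x, h.le_card x⟩
  · exact h.1.injOn (Set.mem_univ x) (Set.mem_univ y) hxy
  · obtain ⟨y, -, hy⟩ := h.1.surjOn (Set.mem_Icc.mpr (Finset.mem_Icc.mp hx))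
    exact ⟨y, by simp, hy⟩

/-- The square of the exponential sum over vertex labels runs over ordered pairs of vertices. The
adjacent pairs have sums `s - l(e)`, which nearly cancel since they fill all but `n` classes
modulo `n + m`; the other `n² - 2m` ordered pairs are estimated trivially. -/
theorem norm_sum_pow_sq_le (h : IsEdgeMagicLabelling G s l) {z : ℂ}
    (hzN : z ^ (Nat.card V + Nat.card G.edgeSet) = 1) (hz : z ≠ 1) :
    ‖∑ v, z ^ l (Sum.inl v)‖ ^ 2
      ≤ (Nat.card V : ℝ) ^ 2 - 2 * Nat.card G.edgeSet + 2 * Nat.card V := by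
  classical
  by_cases hN : Nat.card V + Nat.card G.edgeSet = 0
  · have : IsEmpty V := by
      rw [← Fintype.card_eq_zero_iff, ← Nat.card_eq_fintype_card]; omega
    simp
  have hz1 : ‖z‖ = 1 := Complex.norm_eq_one_of_pow_eq_one hzN hN
  have hz0 : z ≠ 0 := fun h0 => by simp [h0] at hz1
  have hnorm : ∀ x : ℕ, ‖z ^ x‖ = 1 := fun x => by rw [norm_pow, hz1, one_pow]
  have hadj : ‖∑ p : V × V with G.Adj p.1 p.2, z ^ (l (Sum.inl p.1) + l (Sum.inl p.2))‖
      ≤ 2 * Nat.card V := by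
    have e1 : ∑ p : V × V with G.Adj p.1 p.2, z ^ (l (Sum.inl p.1) + l (Sum.inl p.2))
        = ∑ d : G.Dart, z ^ s * z⁻¹ ^ l (Sum.inr ⟨d.edge, d.edge_mem⟩) := by
      symm
      refine Finset.sum_bij' (fun d _ => (d.fst, d.snd))
        (fun p hp => ⟨p, (Finset.mem_filter.1 hp).2⟩) ?_ ?_ ?_ ?_ ?_
      · intro d _; simp
      · intro p hp; simp
      · intro d _; rfl
      · intro p hp; rfl
      · intro d _
        have := h.2 d.fst d.snd d.adj
        change z ^ s * z⁻¹ ^ l (Sum.inr ⟨s(d.fst, d.snd), _⟩) = _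
        rw [← this, pow_add _ (_ + _), mul_assoc, inv_pow, mul_inv_cancel₀ (pow_ne_zero _ hz0),
          mul_one]
    rw [e1, G.sum_dart_edge (fun e => z ^ s * z⁻¹ ^ l (Sum.inr e)), ← Finset.mul_sum,
      eq_neg_of_add_eq_zero_right (h.sum_pow_add_sum_pow_eq_zero (z := z⁻¹)
        (by rw [inv_pow, hzN, inv_one]) (by simp [hz])),
      nsmul_eq_mul, norm_mul, norm_mul, hnorm, norm_neg, one_mul]
    have h3 : ‖∑ v, z⁻¹ ^ l (Sum.inl v)‖ ≤ Nat.card V := by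
      refine (norm_sum_le _ _).trans ?_
      simp [hz1]
    simpa using h3
  have hnadj : ‖∑ p : V × V with ¬ G.Adj p.1 p.2, z ^ (l (Sum.inl p.1) + l (Sum.inl p.2))‖
      ≤ (Nat.card V : ℝ) ^ 2 - 2 * Nat.card G.edgeSet := by
    refine (norm_sum_le _ _).trans ?_
    simp only [hnorm, Finset.sum_const, nsmul_eq_mul, mul_one]
    have h4 := Finset.card_filter_add_card_filter_not (s := (Finset.univ : Finset (V × V)))
      (fun p => G.Adj p.1 p.2)
    have h5 := G.two_mul_card_edgeFinset
    rw [Finset.card_univ, Fintype.card_prod] at h4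
    have h6 : Nat.card G.edgeSet = G.edgeFinset.card := by
      rw [Nat.card_eq_fintype_card, SimpleGraph.edgeFinset_card]
    rw [h6, Nat.card_eq_fintype_card, le_sub_iff_add_le]
    have h7 : ((Finset.univ.filter fun p : V × V => ¬ G.Adj p.1 p.2).card : ℝ)
        + 2 * G.edgeFinset.card = Fintype.card V * Fintype.card V := by
      have : (Finset.univ.filter fun p : V × V => ¬ G.Adj p.1 p.2).card
        + 2 * G.edgeFinset.card = Fintype.card V * Fintype.card V := by
        rw [h5, ← h4, add_comm]
      exact_mod_cast this
    rw [h7, sq]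
  have hsq : (∑ v, z ^ l (Sum.inl v)) ^ 2
      = ∑ p : V × V with G.Adj p.1 p.2, z ^ (l (Sum.inl p.1) + l (Sum.inl p.2))
        + ∑ p : V × V with ¬ G.Adj p.1 p.2, z ^ (l (Sum.inl p.1) + l (Sum.inl p.2)) := by
    rw [Finset.sum_filter_add_sum_filter_not, sq, Finset.sum_mul_sum, Fintype.sum_prod_type]
    simp only [pow_add]
  rw [← norm_pow, hsq]
  refine (norm_add_le _ _).trans ?_
  linarith

/-- The sums of two adjacent labels lie in `[s - N, s - 1]`, `N = n + m`. Hence two vertices with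
`2 l(v) ≥ s`, or two with `2 l(v) < s - N`, are never adjacent. -/
theorem card_sq_add_card_sq_le (h : IsEdgeMagicLabelling G s l) :
    ((Finset.univ.filter fun v : V => s ≤ 2 * l (Sum.inl v)).card : ℝ) ^ 2
      + ((Finset.univ.filter fun v : V =>
          2 * l (Sum.inl v) + (Nat.card V + Nat.card G.edgeSet) < s).card : ℝ) ^ 2
      ≤ (Nat.card V : ℝ) ^ 2 - 2 * Nat.card G.edgeSet := by
  classical
  set P := Finset.univ.filter fun v : V => s ≤ 2 * l (Sum.inl v) with hP
  set Q := Finset.univ.filter fun v : V =>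
          2 * l (Sum.inl v) + (Nat.card V + Nat.card G.edgeSet) < s with hQ
  set R := Finset.univ.filter fun p : V × V => G.Adj p.1 p.2 with hR
  have hPQ : Disjoint (P ×ˢ P) (Q ×ˢ Q) := by
    rw [Finset.disjoint_left]
    rintro ⟨a, b⟩ h1 h2
    simp only [hP, hQ, Finset.mem_product, Finset.mem_filter, Finset.mem_univ, true_and] at h1 h2
    omega
  have hPQR : Disjoint (P ×ˢ P ∪ Q ×ˢ Q) R := by
    rw [Finset.disjoint_left]
    rintro ⟨a, b⟩ h1 h2
    simp only [hP, hQ, hR, Finset.mem_union, Finset.mem_product, Finset.mem_filter,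
      Finset.mem_univ, true_and] at h1 h2
    have := h.2 a b h2
    have h3 := h.one_le (Sum.inr ⟨s(a, b), h2⟩)
    have h4 := h.le_card (Sum.inr ⟨s(a, b), h2⟩)
    omega
  have hle := Finset.card_le_univ ((P ×ˢ P ∪ Q ×ˢ Q) ∪ R)
  rw [Finset.card_union_of_disjoint hPQR, Finset.card_union_of_disjoint hPQ, Finset.card_product,
    Finset.card_product, Fintype.card_prod] at hle
  have h5 := G.two_mul_card_edgeFinset
  have h6 : Nat.card G.edgeSet = G.edgeFinset.card := by
    rw [Nat.card_eq_fintype_card, SimpleGraph.edgeFinset_card]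
  rw [h6, Nat.card_eq_fintype_card, le_sub_iff_add_le]
  have h7 : P.card * P.card + Q.card * Q.card + 2 * G.edgeFinset.card
      ≤ Fintype.card V * Fintype.card V := by
    rw [h5]; exact hle
  have h8 : (P.card * P.card + Q.card * Q.card + 2 * G.edgeFinset.card : ℝ)
      ≤ Fintype.card V * Fintype.card V := by exact_mod_cast h7
  linarith

/-- `norm_sum_pow_sq_le` at the `j`-th nontrivial character, with the phases centred at `s / 2`. -/
theorem norm_sum_exp_le (h : IsEdgeMagicLabelling G s l) {N : ℕ}
    (hN : N = Nat.card V + Nat.card G.edgeSet) {j : ℕ} (hj : 0 < j) (hjN : j < N) :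
    ‖∑ v, Complex.exp ((j * (Real.pi * (2 * l (Sum.inl v) - s) / N) : ℝ) * Complex.I)‖
      ≤ √((Nat.card V : ℝ) ^ 2 - 2 * Nat.card G.edgeSet + 2 * Nat.card V) := by
  have hN0 : (N : ℂ) ≠ 0 := by
    have : N ≠ 0 := by omega
    exact_mod_cast this
  set z : ℂ := Complex.exp (2 * Real.pi * Complex.I / N) ^ j with hz
  have hprim := Complex.isPrimitiveRoot_exp N (by omega)
  have hz1 : z ≠ 1 := hprim.pow_ne_one_of_pos_of_lt hj.ne' hjN
  have hzN : z ^ N = 1 := by rw [hz, pow_right_comm, hprim.pow_eq_one, one_pow]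
  have hterm : ∀ v, Complex.exp ((j * (Real.pi * (2 * l (Sum.inl v) - s) / N) : ℝ) * Complex.I)
      = Complex.exp (((-(j * Real.pi * s / N) : ℝ) : ℂ) * Complex.I) * z ^ l (Sum.inl v) := by
    intro v
    rw [hz, ← Complex.exp_nat_mul, ← Complex.exp_nat_mul, ← Complex.exp_add]
    congr 1
    push_cast
    field_simp
    ring
  simp_rw [hterm]
  rw [← Finset.mul_sum, norm_mul, Complex.norm_exp_ofReal_mul_I, one_mul]
  refine Real.le_sqrt_of_sq_le ?_
  exact h.norm_sum_pow_sq_le (hN ▸ hzN) hz1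

/-- With `φ v = π (2 l(v) - s) / N`, `N = n + m`, the vertices with `sin (φ v) > 0` are counted by
`card_sq_add_card_sq_le`, while `∑ max (sin (φ v)) 0` is close to its average `n / π` because all
Fourier modes but the constant one are small. -/
theorem two_mul_sub_four_le (h : IsEdgeMagicLabelling G s l) (hV : 2 ≤ Nat.card V) :
    2 * (Nat.card V : ℝ) - 4 ≤ (2 + (1 + 2 * √2) * Real.pi)
      * √((Nat.card V : ℝ) ^ 2 - 2 * Nat.card G.edgeSet + 2 * Nat.card V) := by
  classical
  obtain ⟨N, hN⟩ : ∃ N, N = Nat.card V + Nat.card G.edgeSet := ⟨_, rfl⟩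
  have hcount := h.card_sq_add_card_sq_le
  rw [← hN] at hcount
  set k : ℝ := (Nat.card V : ℝ) with hk
  set D := √(k ^ 2 - 2 * Nat.card G.edgeSet + 2 * k) with hD
  have hD0 : 0 ≤ D := Real.sqrt_nonneg _
  have hk0 : 0 ≤ k := by positivity
  have hkV : (Fintype.card V : ℝ) = k := by rw [hk, Nat.card_eq_fintype_card]
  set P := Finset.univ.filter fun v : V => s ≤ 2 * l (Sum.inl v) with hP
  set Q := Finset.univ.filter fun v : V => 2 * l (Sum.inl v) + N < s with hQ
  have hN0 : 0 < N := by omega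
  have hN0' : (0 : ℝ) < N := by exact_mod_cast hN0
  set φ : V → ℝ := fun v => Real.pi * (2 * l (Sum.inl v) - s) / N with hφ
  have hexp : ∀ j : ℕ, 0 < j → j < N → ‖∑ v, Complex.exp ((j * φ v : ℝ) * Complex.I)‖ ≤ D :=
    fun j h1 h2 => h.norm_sum_exp_le hN h1 h2
  have hcos : ∀ j : ℕ, 0 < j → j < N → ∑ v, Real.cos (j * φ v) ≤ D := by
    intro j h1 h2
    refine le_trans ?_ ((Complex.re_le_norm _).trans (hexp j h1 h2))
    rw [Complex.re_sum]
    simp only [Complex.exp_ofReal_mul_I_re, le_refl]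
  have hsin : -D ≤ ∑ v, Real.sin (φ v) := by
    have h1 := (Complex.abs_im_le_norm _).trans (hexp 1 one_pos (by omega))
    rw [Complex.im_sum] at h1
    simp only [Complex.exp_ofReal_mul_I_im, Nat.cast_one, one_mul] at h1
    exact (abs_le.mp h1).1
  -- Only the modes `2j < N` are used, as the sum at frequency `N` is not small.
  set J := (N - 1) / 2 with hJ
  have habs : k / 2 - 1 - D / 2 ≤ Real.pi / 4 * ∑ v, |Real.sin (φ v)| := by
    have h1 := Finset.sum_le_sum fun v (_ : v ∈ Finset.univ) => div_sub_sum_cos_le_abs_sin J (φ v)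
    rw [Finset.sum_sub_distrib, ← Finset.mul_sum, Finset.sum_comm, Finset.sum_const,
      Finset.card_univ, nsmul_eq_mul, hkV] at h1
    have h2 : ∑ j ∈ Finset.range J, ∑ v,
        Real.cos (2 * (j + 1 : ℕ) * φ v) / (4 * ((j + 1 : ℕ) : ℝ) ^ 2 - 1)
        ≤ D * (J / (2 * J + 1)) := by
      rw [← sum_one_div_four_mul_sq_sub_one, Finset.mul_sum]
      refine Finset.sum_le_sum fun j hj => ?_
      rw [← Finset.sum_div, mul_one_div]
      have hjJ := Finset.mem_range.mp hj
      have h3 := hcos (2 * (j + 1)) (by omega) (by omega)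
      have h4 : (0 : ℝ) ≤ 4 * ((j + 1 : ℕ) : ℝ) ^ 2 - 1 := by
        push_cast; nlinarith [(Nat.cast_nonneg j : (0 : ℝ) ≤ j)]
      refine div_le_div_of_nonneg_right ?_ h4
      push_cast at h3 ⊢
      exact h3
    have hJ1 : (0 : ℝ) < 2 * J + 1 := by positivity
    have h5 : (J : ℝ) / (2 * J + 1) = 1 / 2 - 1 / (2 * (2 * J + 1)) := by field_simp; ring
    have h6 : k * (1 / (2 * (2 * J + 1))) ≤ 1 := by
      rw [mul_one_div, div_le_one (by positivity)]
      have h7 : Nat.card V ≤ 2 * (2 * J + 1) := by omega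
      rw [hk]
      exact_mod_cast h7
    have h8 : 0 ≤ D * (1 / (2 * (2 * J + 1))) := by positivity
    rw [h5] at h1 h2
    nlinarith
  have hpos : ∑ v, (Real.sin (φ v) + |Real.sin (φ v)|) ≤ 2 * (P.card + Q.card) := by
    have hdisj : Disjoint P Q := by
      rw [Finset.disjoint_left]
      intro v h1 h2
      simp only [hP, hQ, Finset.mem_filter, Finset.mem_univ, true_and] at h1 h2
      omega
    have h1 : ∀ v, Real.sin (φ v) + |Real.sin (φ v)| ≤ if v ∈ P ∪ Q then 2 else 0 := by
      intro v
      split_ifs with hv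
      · rw [abs_eq_max_neg]
        have := Real.abs_sin_le_one (φ v)
        rw [abs_eq_max_neg] at this
        linarith [le_max_left (Real.sin (φ v)) (-Real.sin (φ v))]
      · simp only [hP, hQ, Finset.mem_union, Finset.mem_filter, Finset.mem_univ, true_and,
          not_or, not_le, not_lt] at hv
        have hv1 : (2 * l (Sum.inl v) : ℝ) ≤ s := by exact_mod_cast hv.1.le
        have hv2 : (s : ℝ) ≤ 2 * l (Sum.inl v) + N := by exact_mod_cast hv.2
        have h2 : Real.sin (φ v) ≤ 0 := by
          refine Real.sin_nonpos_of_nonpos_of_neg_pi_le ?_ ?_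
          · rw [hφ]
            exact div_nonpos_of_nonpos_of_nonneg
              (mul_nonpos_of_nonneg_of_nonpos Real.pi_pos.le (by linarith)) hN0'.le
          · rw [hφ, le_div_iff₀ hN0']
            nlinarith [Real.pi_pos]
        rw [abs_of_nonpos h2]
        linarith
    refine (Finset.sum_le_sum fun v _ => h1 v).trans ?_
    rw [Finset.sum_ite_mem, Finset.univ_inter, Finset.sum_const,
      Finset.card_union_of_disjoint hdisj, nsmul_eq_mul]
    push_cast
    linarith
  -- `P` and `Q` together form a half-circle modulo `N`, so the two counts are bounded jointly.
  have hPQ : (P.card + Q.card : ℝ) ≤ √2 * D := by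
    rw [hD, ← Real.sqrt_mul (by norm_num)]
    refine Real.le_sqrt_of_sq_le ?_
    nlinarith [sq_nonneg ((P.card : ℝ) - Q.card)]
  rw [Finset.sum_add_distrib] at hpos
  have hpi := Real.pi_pos
  have hfin : ∑ v, |Real.sin (φ v)| ≤ 2 * (√2 * D) + D := by linarith
  have := mul_le_mul_of_nonneg_left hfin (by positivity : 0 ≤ Real.pi / 4)
  nlinarith

end IsEdgeMagicLabelling

/-! ### Mrose's basis and dense edge-magic graphs -/

/-- An `n`-subset `A` of `{1, …, N}` such that `s - x` is a sum of two distinct elements of `A` for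
each `x ∈ {1, …, N}` yields an edge-magic graph: the vertices are labelled by `A`, and each
`x ∉ A` labels one edge, whose ends have labels summing to `s - x`. -/
theorem sub_mem_edgeMagicSizes {n N s : ℕ} {A : Finset ℕ} (hA : A ⊆ Finset.Icc 1 N)
    (hcard : A.card = n)
    (hsum : ∀ x ∈ Finset.Icc 1 N, ∃ a ∈ A, ∃ b ∈ A, a ≠ b ∧ a + b + x = s) :
    N - n ∈ edgeMagicSizes n := by
  classical
  set e := A.orderIsoOfFin hcard
  have hX : ∀ x : (Finset.Icc 1 N \ A : Finset ℕ), ∃ i j : Fin n, i ≠ j ∧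
      (e i : ℕ) + e j + x = s := by
    rintro ⟨x, hx⟩
    obtain ⟨a, ha, b, hb, hab, h⟩ := hsum x (Finset.mem_sdiff.mp hx).1
    refine ⟨e.symm ⟨a, ha⟩, e.symm ⟨b, hb⟩, fun h' => hab ?_, by simpa using h⟩
    simpa using e.symm.injective h'
  choose i j hij hs using hX
  set E : (Finset.Icc 1 N \ A : Finset ℕ) → Sym2 (Fin n) := fun x => s(i x, j x) with hE
  set G := SimpleGraph.fromEdgeSet (Set.range E) with hG
  have hsumE : ∀ x a b, E x = s(a, b) → (e a : ℕ) + e b + x = s := by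
    intro x a b h
    rw [← hs x]
    rcases Sym2.eq_iff.mp h with ⟨rfl, rfl⟩ | ⟨rfl, rfl⟩
    · rfl
    · rw [add_comm (e (j x) : ℕ)]
  have hinj : Function.Injective E := by
    intro x y h
    have h1 := hsumE x (i y) (j y) h
    have h2 := hs y
    exact Subtype.ext (by omega)
  have hGE : G.edgeSet = Set.range E := by
    rw [hG, SimpleGraph.edgeSet_fromEdgeSet, sdiff_eq_left, Set.disjoint_left]
    rintro _ ⟨x, rfl⟩ h
    exact hij x (by simpa [hE] using h)
  let ψ : (Finset.Icc 1 N \ A : Finset ℕ) ≃ G.edgeSet :=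
    (Equiv.ofInjective E hinj).trans (Equiv.setCongr hGE.symm)
  have hψ : ∀ x, (ψ x : Sym2 (Fin n)) = E x := fun x => rfl
  have hGcard : Nat.card G.edgeSet = N - n := by
    rw [← Nat.card_congr ψ, Nat.card_eq_fintype_card, Fintype.card_coe,
      Finset.card_sdiff_of_subset hA, hcard, Nat.card_Icc, Nat.add_sub_cancel]
  have hnN : n ≤ N := by
    have := Finset.card_le_card hA
    rwa [hcard, Nat.card_Icc, Nat.add_sub_cancel] at this
  refine ⟨G, ⟨s, Sum.elim (fun v => (e v : ℕ)) (fun d => (ψ.symm d : ℕ)), ⟨?_, ?_, ?_⟩, ?_⟩,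
    hGcard⟩
  · rw [hGcard, Nat.card_eq_fintype_card, Fintype.card_fin, Nat.add_sub_cancel' hnN]
    rintro (v | d) -
    · exact Finset.mem_Icc.mp (hA (e v).2)
    · exact Finset.mem_Icc.mp (Finset.mem_sdiff.mp (ψ.symm d).2).1
  · rintro (v | d) - (w | d') - h
    · exact congrArg Sum.inl (e.injective (Subtype.ext h))
    · simp only [Sum.elim_inl, Sum.elim_inr] at h
      exact absurd (h ▸ (e v).2) (Finset.mem_sdiff.mp (ψ.symm d').2).2
    · simp only [Sum.elim_inl, Sum.elim_inr] at h
      exact absurd (h ▸ (e w).2) (Finset.mem_sdiff.mp (ψ.symm d).2).2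
    · exact congrArg Sum.inr (ψ.symm.injective (Subtype.ext h))
  · rw [hGcard, Nat.card_eq_fintype_card, Fintype.card_fin, Nat.add_sub_cancel' hnN]
    intro x hx
    by_cases hxA : x ∈ A
    · exact ⟨Sum.inl (e.symm ⟨x, hxA⟩), trivial, by simp⟩
    · exact ⟨Sum.inr (ψ ⟨x, Finset.mem_sdiff.mpr ⟨Finset.mem_Icc.mpr hx, hxA⟩⟩), trivial, by simp⟩
  · intro a b h
    simp only [Sum.elim_inl, Sum.elim_inr]
    refine hsumE _ a b ?_
    rw [← hψ, Equiv.apply_symm_apply]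

/-- Mrose's additive basis: a union of five arithmetic progressions with `7t + 3` terms in total,
whose pairwise sums cover an initial segment of length about `14 t² = (2/7) (7t)²`. -/
def mroseBasis (t : ℕ) : Finset ℕ :=
  Finset.range (t + 1)
    ∪ (Finset.Icc 2 (3 * t + 1)).image (fun j => t * j)
    ∪ (Finset.range t).image (fun i => 3 * (t * t) + 2 * t + i * (t + 1))
    ∪ (Finset.range (t + 1)).image (fun i => 6 * (t * t) + 4 * t + i)
    ∪ (Finset.range (t + 1)).image (fun i => 10 * (t * t) + 7 * t + i)

theorem card_mroseBasis_le (t : ℕ) : (mroseBasis t).card ≤ 7 * t + 3 := by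
  unfold mroseBasis
  refine (Finset.card_union_le _ _).trans ?_
  have h1 := Finset.card_union_le (Finset.range (t + 1)
    ∪ (Finset.Icc 2 (3 * t + 1)).image (fun j => t * j)
    ∪ (Finset.range t).image (fun i => 3 * (t * t) + 2 * t + i * (t + 1)))
    ((Finset.range (t + 1)).image (fun i => 6 * (t * t) + 4 * t + i))
  have h2 := Finset.card_union_le (Finset.range (t + 1)
    ∪ (Finset.Icc 2 (3 * t + 1)).image (fun j => t * j))
    ((Finset.range t).image (fun i => 3 * (t * t) + 2 * t + i * (t + 1)))
  have h3 := Finset.card_union_le (Finset.range (t + 1))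
    ((Finset.Icc 2 (3 * t + 1)).image (fun j => t * j))
  have h4 := Finset.card_image_le (s := Finset.Icc 2 (3 * t + 1)) (f := fun j => t * j)
  have h5 := Finset.card_image_le (s := Finset.range t)
    (f := fun i => 3 * (t * t) + 2 * t + i * (t + 1))
  have h6 := Finset.card_image_le (s := Finset.range (t + 1))
    (f := fun i => 6 * (t * t) + 4 * t + i)
  have h7 := Finset.card_image_le (s := Finset.range (t + 1))
    (f := fun i => 10 * (t * t) + 7 * t + i)
  simp only [Finset.card_range, Nat.card_Icc] at h3 h4 h5 h6 h7
  omega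

theorem mem_mroseBasis {t x : ℕ} : x ∈ mroseBasis t ↔
    x ≤ t ∨ (∃ j, 2 ≤ j ∧ j ≤ 3 * t + 1 ∧ t * j = x)
      ∨ (∃ i < t, 3 * (t * t) + 2 * t + i * (t + 1) = x)
      ∨ (∃ i ≤ t, 6 * (t * t) + 4 * t + i = x) ∨ (∃ i ≤ t, 10 * (t * t) + 7 * t + i = x) := by
  simp only [mroseBasis, Finset.mem_union, Finset.mem_range, Finset.mem_image, Finset.mem_Icc,
    Nat.lt_succ_iff, or_assoc, and_assoc]

theorem lt_of_mem_mroseBasis {t x : ℕ} (ht : 1 ≤ t) (hx : x ∈ mroseBasis t) :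
    x < 14 * (t * t) + 10 * t - 1 := by
  have htt : t ≤ t * t := Nat.le_mul_of_pos_left t ht
  rcases mem_mroseBasis.mp hx with h | ⟨j, -, h, rfl⟩ | ⟨i, h, rfl⟩ | ⟨i, h, rfl⟩ | ⟨i, h, rfl⟩
  · omega
  · have : t * j ≤ t * (3 * t + 1) := Nat.mul_le_mul_left t h
    have e : t * (3 * t + 1) = 3 * (t * t) + t := by ring
    omega
  · have : i * (t + 1) ≤ t * (t + 1) := Nat.mul_le_mul_right _ h.le
    have e : t * (t + 1) = t * t + t := by ring
    omega
  · omega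
  · omega

/-- Adding the second and third progressions to a block `[c, c + t]` covers an interval. -/
theorem exists_add_mem_mroseBasis {t c x : ℕ} (ht : 1 ≤ t) (h1 : c + 2 * t ≤ x)
    (h2 : x + 1 ≤ c + 4 * (t * t) + 3 * t) :
    ∃ i ≤ t, ∃ b ∈ mroseBasis t, 2 * t ≤ b ∧ b < 6 * (t * t) + 4 * t ∧ c + i + b = x := by
  have htt : t ≤ t * t := Nat.le_mul_of_pos_left t ht
  by_cases h : x ≤ c + 3 * (t * t) + 2 * t
  · -- `j` is the quotient by `t`, except at the right end of the interval
    by_cases hend : x = c + 3 * (t * t) + 2 * t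
    · have e : t * (3 * t + 1) = 3 * (t * t) + t := by ring
      exact ⟨t, le_rfl, t * (3 * t + 1),
        mem_mroseBasis.mpr (Or.inr (Or.inl ⟨_, by omega, le_rfl, rfl⟩)), by omega, by omega,
        by omega⟩
    · obtain ⟨y, rfl⟩ : ∃ y, x = c + y := ⟨x - c, by omega⟩
      have hy := Nat.div_add_mod y t
      have hr := Nat.mod_lt y ht
      have hq2 : 2 ≤ y / t := (Nat.le_div_iff_mul_le ht).mpr (by omega)
      have hq3 : y / t < 3 * t + 2 := by
        rw [Nat.div_lt_iff_lt_mul ht]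
        have e : (3 * t + 2) * t = 3 * (t * t) + 2 * t := by ring
        omega
      have e2 : t * 2 ≤ t * (y / t) := Nat.mul_le_mul_left t hq2
      exact ⟨y % t, hr.le, t * (y / t),
        mem_mroseBasis.mpr (Or.inr (Or.inl ⟨_, hq2, by omega, rfl⟩)), by omega, by omega,
        by omega⟩
  · obtain ⟨y, rfl⟩ : ∃ y, x = c + 3 * (t * t) + 2 * t + y :=
      ⟨x - (c + 3 * (t * t) + 2 * t), by omega⟩
    have hy := Nat.div_add_mod' y (t + 1)
    have hr := Nat.mod_lt y (Nat.succ_pos t)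
    have hq : y / (t + 1) < t := by
      rw [Nat.div_lt_iff_lt_mul (Nat.succ_pos t)]
      have e : t * (t + 1) = t * t + t := by ring
      rw [Nat.succ_eq_add_one]
      omega
    exact ⟨y % (t + 1), Nat.lt_succ_iff.mp hr, _,
      mem_mroseBasis.mpr (Or.inr (Or.inr (Or.inl ⟨_, hq, rfl⟩))), by omega, by omega, by omega⟩

/-- Every `x` in `[1, 14t² + 10t - 1]` is a sum of two distinct elements of Mrose's basis. -/
theorem exists_add_eq_of_mroseBasis {t x : ℕ} (ht : 1 ≤ t) (h1 : 1 ≤ x)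
    (h2 : x ≤ 14 * (t * t) + 10 * t - 1) :
    ∃ a ∈ mroseBasis t, ∃ b ∈ mroseBasis t, a ≠ b ∧ a + b = x := by
  have htt : t ≤ t * t := Nat.le_mul_of_pos_left t ht
  have hA : ∀ i ≤ t, i ∈ mroseBasis t := fun i hi => mem_mroseBasis.mpr (Or.inl hi)
  have hD : ∀ i ≤ t, 6 * (t * t) + 4 * t + i ∈ mroseBasis t := fun i hi =>
    mem_mroseBasis.mpr (Or.inr (Or.inr (Or.inr (Or.inl ⟨i, hi, rfl⟩))))
  have hE : ∀ i ≤ t, 10 * (t * t) + 7 * t + i ∈ mroseBasis t := fun i hi =>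
    mem_mroseBasis.mpr (Or.inr (Or.inr (Or.inr (Or.inr ⟨i, hi, rfl⟩))))
  by_cases c1 : x ≤ t
  · exact ⟨0, hA 0 (by omega), x, hA x c1, by omega, by omega⟩
  by_cases c2 : x < 2 * t
  · exact ⟨x - t, hA _ (by omega), t, hA t le_rfl, by omega, by omega⟩
  by_cases c3 : x < 4 * (t * t) + 3 * t
  · obtain ⟨i, hi, b, hb, hb1, hb2, h⟩ :=
      exists_add_mem_mroseBasis (c := 0) (x := x) ht (by omega) (by omega)
    exact ⟨i, hA i hi, b, hb, by omega, by omega⟩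
  by_cases c4 : x < 6 * (t * t) + 4 * t
  · -- second plus third progression: the residue of `x` modulo `t` selects the term of the third
    have hx := Nat.div_add_mod x t
    have hr := Nat.mod_lt x ht
    set q := x / t
    set r := x % t
    have hq1 : 4 * t + 3 ≤ q := (Nat.le_div_iff_mul_le ht).mpr (by nlinarith)
    have hq2 : q < 6 * t + 4 := by
      rw [Nat.div_lt_iff_lt_mul ht]
      nlinarith
    obtain ⟨j, hj⟩ : ∃ j, q = 3 * t + 2 + r + j := ⟨q - (3 * t + 2 + r), by omega⟩
    have hj3 : t * j ≤ t * (3 * t + 1) := Nat.mul_le_mul_left t (by omega)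
    have e : t * (3 * t + 1) = 3 * (t * t) + t := by ring
    refine ⟨t * j, mem_mroseBasis.mpr (Or.inr (Or.inl ⟨j, by omega, by omega, rfl⟩)),
      3 * (t * t) + 2 * t + r * (t + 1),
      mem_mroseBasis.mpr (Or.inr (Or.inr (Or.inl ⟨r, hr, rfl⟩))), by omega, ?_⟩
    rw [← hx, hj]
    ring
  by_cases c5 : x ≤ 6 * (t * t) + 6 * t
  · by_cases c : x ≤ 6 * (t * t) + 5 * t
    · exact ⟨0, hA 0 (by omega), 6 * (t * t) + 4 * t + (x - (6 * (t * t) + 4 * t)),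
        hD _ (by omega), by omega, by omega⟩
    · exact ⟨t, hA t le_rfl, 6 * (t * t) + 4 * t + (x - (6 * (t * t) + 5 * t)),
        hD _ (by omega), by omega, by omega⟩
  by_cases c6 : x < 10 * (t * t) + 7 * t
  · obtain ⟨i, hi, b, hb, hb1, hb2, h⟩ :=
      exists_add_mem_mroseBasis (c := 6 * (t * t) + 4 * t) (x := x) ht (by omega) (by omega)
    exact ⟨_, hD i hi, b, hb, by omega, by omega⟩
  by_cases c7 : x ≤ 10 * (t * t) + 9 * t
  · by_cases c : x ≤ 10 * (t * t) + 8 * t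
    · exact ⟨0, hA 0 (by omega), 10 * (t * t) + 7 * t + (x - (10 * (t * t) + 7 * t)),
        hE _ (by omega), by omega, by omega⟩
    · exact ⟨t, hA t le_rfl, 10 * (t * t) + 7 * t + (x - (10 * (t * t) + 8 * t)),
        hE _ (by omega), by omega, by omega⟩
  obtain ⟨i, hi, b, hb, hb1, hb2, h⟩ :=
    exists_add_mem_mroseBasis (c := 10 * (t * t) + 7 * t) (x := x) ht (by omega) (by omega)
  exact ⟨_, hE i hi, b, hb, by omega, by omega⟩

theorem le_maxEdgeMagicSize {n t : ℕ} (ht : 1 ≤ t) (h1 : 7 * t + 3 ≤ n)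
    (h2 : n ≤ 14 * (t * t) + 10 * t - 1) :
    14 * (t * t) + 10 * t - 1 - n ≤ maxEdgeMagicSize n := by
  set N := 14 * (t * t) + 10 * t - 1
  obtain ⟨A, hBA, hAN, hcard⟩ := Finset.exists_subsuperset_card_eq
    (s := (mroseBasis t).image (· + 1)) (t := Finset.Icc 1 N) (n := n)
    (by
      intro x hx
      obtain ⟨b, hb, rfl⟩ := Finset.mem_image.mp hx
      exact Finset.mem_Icc.mpr ⟨by omega, lt_of_mem_mroseBasis ht hb⟩)
    (Finset.card_image_le.trans ((card_mroseBasis_le t).trans h1))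
    (by rw [Nat.card_Icc]; exact h2)
  refine (maxEdgeMagicSize_isGreatest n).2
    (sub_mem_edgeMagicSizes (s := N + 3) hAN hcard fun x hx => ?_)
  rw [Finset.mem_Icc] at hx
  obtain ⟨a, ha, b, hb, hab, h⟩ := exists_add_eq_of_mroseBasis (x := N + 1 - x) ht (by omega)
    (show _ ≤ N by omega)
  exact ⟨a + 1, hBA (Finset.mem_image_of_mem _ ha), b + 1, hBA (Finset.mem_image_of_mem _ hb),
    by omega, by omega⟩

/-! ### The two bounds -/

theorem two_sevenths_mul_sq_sub_le (n : ℕ) :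
    2 / 7 * (n : ℝ) ^ 2 - 8 * n ≤ (maxEdgeMagicSize n : ℝ) := by
  have hn0 : (0 : ℝ) ≤ n := n.cast_nonneg
  by_cases hn : n < 10
  · have : (n : ℝ) < 10 := by exact_mod_cast hn
    have : (0 : ℝ) ≤ maxEdgeMagicSize n := Nat.cast_nonneg _
    nlinarith
  obtain ⟨t, ht⟩ : ∃ t, t = (n - 3) / 7 := ⟨_, rfl⟩
  have h1 : 7 * t + 3 ≤ n := by omega
  have h2 : n ≤ 7 * t + 9 := by omega
  have ht1 : 1 ≤ t := by omega
  have htt : t ≤ t * t := Nat.le_mul_of_pos_left t ht1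
  have h := le_maxEdgeMagicSize ht1 h1 (by omega)
  have h' : 14 * (t * t) + 10 * t ≤ maxEdgeMagicSize n + n + 1 := by omega
  have h'' : (14 * (t * t) + 10 * t : ℝ) ≤ maxEdgeMagicSize n + n + 1 := by exact_mod_cast h'
  have h2' : (n : ℝ) ≤ 7 * t + 9 := by exact_mod_cast h2
  have h3' : (10 : ℝ) ≤ n := by exact_mod_cast not_lt.mp hn
  nlinarith

theorem edgeMagicConst_bounds : 0.489 ≤ edgeMagicConst ∧ edgeMagicConst < 0.490 := by
  have h1 : (1.41 : ℝ) < √2 := Real.lt_sqrt_of_sq_lt (by norm_num)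
  have h2 : √2 < (1.415 : ℝ) := (Real.sqrt_lt' (by norm_num)).mpr (by norm_num)
  have h3 := Real.pi_gt_d2
  have h4 := Real.pi_lt_d4
  unfold edgeMagicConst
  set W := 2 + (1 + 2 * √2) * Real.pi with hW
  have h5 : 13.9 < W := by nlinarith
  have h6 : W < 14.1 := by nlinarith
  have h7 : 0 < W ^ 2 := by positivity
  constructor
  · have : 2 / W ^ 2 ≤ 0.011 := by rw [div_le_iff₀ h7]; nlinarith
    linarith
  · have : 0.010 < 2 / W ^ 2 := by rw [lt_div_iff₀ h7]; nlinarith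
    linarith

theorem maxEdgeMagicSize_le (n : ℕ) :
    (maxEdgeMagicSize n : ℝ) ≤ edgeMagicConst * (n : ℝ) ^ 2 + 9 * n := by
  obtain ⟨G, ⟨s, l, hl⟩, hm⟩ := (maxEdgeMagicSize_isGreatest n).1
  have hn0 : (0 : ℝ) ≤ n := n.cast_nonneg
  have hV : Nat.card (Fin n) = n := by simp
  by_cases hn : n < 2
  · have h := hl.card_sq_add_card_sq_le
    rw [hV, hm] at h
    have hn' : (n : ℝ) < 2 := by exact_mod_cast hn
    have hc := edgeMagicConst_bounds.1
    nlinarith [mul_nonneg (by linarith : 0 ≤ edgeMagicConst) (sq_nonneg (n : ℝ))]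
  have h := hl.two_mul_sub_four_le (by omega)
  have hX : (0 : ℝ) ≤ (n : ℝ) ^ 2 - 2 * maxEdgeMagicSize n + 2 * n := by
    have h := hl.card_sq_add_card_sq_le
    rw [hV, hm] at h
    nlinarith
  rw [hV, hm] at h
  unfold edgeMagicConst
  set W := 2 + (1 + 2 * √2) * Real.pi with hW
  have hW2 : 2 ≤ W := by
    have : 0 ≤ (1 + 2 * √2) * Real.pi := by positivity
    linarith
  have hn' : (2 : ℝ) ≤ n := by exact_mod_cast not_lt.mp hn
  have h1 := pow_le_pow_left₀ (by linarith) h 2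
  rw [mul_pow, Real.sq_sqrt hX] at h1
  have hWpos : 0 < W ^ 2 := by positivity
  have h2 : (2 * (n : ℝ) - 4) ^ 2 / W ^ 2 ≤ (n : ℝ) ^ 2 - 2 * maxEdgeMagicSize n + 2 * n := by
    rw [div_le_iff₀ hWpos]
    linarith
  have h3 : 4 * (n : ℝ) ^ 2 / W ^ 2 - 4 * n ≤ (2 * (n : ℝ) - 4) ^ 2 / W ^ 2 := by
    rw [sub_le_iff_le_add, div_le_iff₀ hWpos, add_mul, div_mul_cancel₀ _ hWpos.ne']
    have hW4 : 4 ≤ W ^ 2 := by nlinarith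
    nlinarith [mul_le_mul_of_nonneg_left hW4 hn0]
  have h4 : (1 / 2 - 2 / W ^ 2) * (n : ℝ) ^ 2 = n ^ 2 / 2 - (4 * (n : ℝ) ^ 2 / W ^ 2) / 2 := by
    ring
  rw [h4]
  linarith

theorem theorem1 :
    (∃ f : ℕ → ℝ, f =O[atTop] (fun n : ℕ => (n : ℝ)) ∧
      ∀ n : ℕ, 2 / 7 * (n : ℝ) ^ 2 + f n ≤ (maxEdgeMagicSize n : ℝ)) ∧
    (∃ g : ℕ → ℝ, Tendsto g atTop (𝓝 0) ∧
      ∀ n : ℕ, (maxEdgeMagicSize n : ℝ) ≤ (edgeMagicConst + g n) * (n : ℝ) ^ 2) ∧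
    (0.489 ≤ edgeMagicConst ∧ edgeMagicConst < 0.490) := by
  refine ⟨⟨fun n => -8 * n, isBigO_const_mul_self _ _ _, fun n => ?_⟩,
    ⟨fun n => 9 / n, tendsto_const_div_atTop_nhds_zero_nat 9, fun n => ?_⟩, edgeMagicConst_bounds⟩
  · linarith [two_sevenths_mul_sq_sub_le n]
  · have h := maxEdgeMagicSize_le n
    rcases Nat.eq_zero_or_pos n with rfl | hn
    · simpa using h
    · have : (n : ℝ) ≠ 0 := by positivity
      rwa [add_mul, show 9 / (n : ℝ) * (n : ℝ) ^ 2 = 9 * n by field_simp]
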